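/- **Model.** Time is discrete. An input is a finite sequence of packets; each packet $p$ has an arrival step $r_p$, a value $w_p\ge 0$ and an integer deadline $d_p$. A single queue stores at most $b\in\mathbb Z^+$ packets at any time. In each step the packets arriving in that step are first processed (each is put into the queue or dropped for good; packets in the queue may also be dropped for good at any time, and a packet $p$ is dropped when its deadline $d_p$ has passed), and then at most one packet of the queue is sent. The gain of a schedule is the total value of the packets it sends, each by its deadline. **Algorithm ME** (parameter $\alpha$). Each packet $p$ in the queue has a virtual deadline $t_p$, set to $d_p$ on arrival. For a set $S$ of packets with virtual deadlines and a time $t$, $\mathrm{OPS}(S,t)$ goes through $S$ in non-increasing order of value (ties: larger virtual deadline first), puts each packet $p$ into the largest-indexed free slot among the slots $0,\dots,\min\{t_p-t,\,b-1\}$, and discards $p$ if there is none; finally the chosen packets are sorted by non-decreasing virtual deadline (ties: larger value first) and put in this order into the slots $0,1,2,\dots$. In step $t$, ME considers the arriving packets one by one in their order in the input: for each arrival $p$ it computes $\mathrm{OPS}(Q\cup\{p\},t)$, where $Q$ is the current queue, drops all packets not chosen, and sets the virtual deadline of the packet in slot $i$ to $t+i$; if no packet arrives in step $t$, it does the same once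 with $\mathrm{OPS}(Q,t)$. Then, if the queue is not empty, let $e$ be the packet with the earliest virtual deadline and $h$ the packet of maximum value (ties: earliest virtual deadline); ME sends $e$ if $w_e\ge w_h/\alpha$, and $h$ otherwise. ME is a deterministic online algorithm, and it is memoryless: its decisions depend only on the current time, the packets in the queue with their virtual deadlines, and the new arrivals. **Theorem.** For every queue capacity $b\in\mathbb Z^+$, ME with $\alpha=2$ is strictly $3$-competitive: on every input, ME produces a schedule that obeys the rules of the model, and every (offline) schedule that obeys these rules on this input, in particular an optimal one, gains at most $3$ times the gain of ME. -/

import Mathlib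

open scoped NNReal

noncomputable section

namespace BoundedQueue

/-! ### The finite queue model -/

/-- A packet: the time step in which it arrives, its non-negative value, and the last time step
in which it may be sent. -/
structure Packet where
  release : ℕ
  value : ℝ≥0
  deadline : ℕ

/-- What a scheduler does on an input of `n` packets: `buffer t` is the content of its queue in
step `t`, after the arrivals of that step have been processed and before the delivery, and
`sent t` is the packet delivered in step `t`, if any. -/
structure Schedule (n : ℕ) where
  buffer : ℕ → Finset (Fin n)
  sent : ℕ → Option (Fin n)

/-- The rules of the model with queue capacity `b`. Packets can be dropped at any time, hence the
one-sided conditions on the buffer; a packet that was dropped or sent never comes back. -/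
structure Schedule.Feasible {n : ℕ} (b : ℕ) (I : Fin n → Packet) (S : Schedule n) : Prop where
  capacity : ∀ t, (S.buffer t).card ≤ b
  not_expired : ∀ t, ∀ j ∈ S.buffer t, t ≤ (I j).deadline
  start : ∀ j ∈ S.buffer 0, (I j).release = 0
  next : ∀ t, ∀ j ∈ S.buffer (t + 1),
    (I j).release = t + 1 ∨ (j ∈ S.buffer t ∧ S.sent t ≠ some j)
  sent_mem : ∀ t, ∀ j, S.sent t = some j → j ∈ S.buffer t

open Classical in
/-- Weighted throughput: the total value of the packets that are sent. -/
def Schedule.throughput {n : ℕ} (I : Fin n → Packet) (S : Schedule n) : ℝ≥0 :=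
  ∑ j : Fin n, if ∃ t, S.sent t = some j then (I j).value else 0

/-! ### Deterministic memoryless online algorithms -/

/-- A packet in the queue of an online algorithm: its name, its characteristics, and its
virtual deadline. -/
structure Pending (ι : Type) where
  name : ι
  packet : Packet
  vdl : ℕ

/-- A deterministic memoryless online algorithm: in each step it forms its new queue from the
current one and the packets that arrive in this step (in their order of arrival), and then
chooses the packet to send from the queue. -/
structure MemorylessAlgorithm (ι : Type) where
  accept : (t : ℕ) → List (Pending ι) → List (ι × Packet) → List (Pending ι)
  select : (t : ℕ) → List (Pending ι) → Option (Pending ι)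

/-- The packets that arrive in step `t`, in the order of the input sequence. -/
def arrivals {n : ℕ} (I : Fin n → Packet) (t : ℕ) : List (Fin n × Packet) :=
  ((List.finRange n).filter fun j => (I j).release = t).map fun j => (j, I j)

namespace MemorylessAlgorithm

/-- The queue `Q` after the delivery in step `t`. -/
def afterDelivery {n : ℕ} (A : MemorylessAlgorithm (Fin n)) (t : ℕ)
    (Q : List (Pending (Fin n))) : List (Pending (Fin n)) :=
  match A.select t Q with
  | none => Q
  | some s => Q.filter fun q => q.name ≠ s.name

/-- The queue in step `t`, after the arrivals and before the delivery; initially it is empty. -/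
def queue {n : ℕ} (A : MemorylessAlgorithm (Fin n)) (I : Fin n → Packet) :
    ℕ → List (Pending (Fin n))
  | 0 => A.accept 0 [] (arrivals I 0)
  | t + 1 => A.accept (t + 1) (A.afterDelivery t (queue A I t)) (arrivals I (t + 1))

/-- The schedule that the algorithm produces on the input `I`. -/
def run {n : ℕ} (A : MemorylessAlgorithm (Fin n)) (I : Fin n → Packet) : Schedule n where
  buffer t := ((A.queue I t).map Pending.name).toFinset
  sent t := (A.select t (A.queue I t)).map Pending.name

end MemorylessAlgorithm

/-- Strict `k`-competitiveness for queue capacity `b`: on every input the algorithm obeys the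
rules of the model, and no offline schedule, in particular no optimal one, gains more than `k`
times what the algorithm gains. -/
def StrictlyCompetitive (k : ℝ≥0) (b : ℕ) (A : (n : ℕ) → MemorylessAlgorithm (Fin n)) : Prop :=
  ∀ (n : ℕ) (I : Fin n → Packet),
    ((A n).run I).Feasible b I ∧
      ∀ S : Schedule n, S.Feasible b I → S.throughput I ≤ k * ((A n).run I).throughput I

/-! ### The algorithm ME -/

variable {ι : Type}

/-- Non-increasing value, ties broken in favor of the larger virtual deadline. -/
def heavierFirst (p q : Pending ι) : Prop :=
  q.packet.value < p.packet.value ∨ (p.packet.value = q.packet.value ∧ q.vdl ≤ p.vdl)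

/-- Non-decreasing virtual deadline, ties broken in favor of the larger value. -/
def earlierFirst (p q : Pending ι) : Prop :=
  p.vdl < q.vdl ∨ (p.vdl = q.vdl ∧ q.packet.value ≤ p.packet.value)

/-- The latest of the slots `0, …, b - 1` that is not in `occupied` and in which a packet with
virtual deadline `d` can be put at time `t`, slot `i` standing for time step `t + i`. -/
def latestFreeSlot (b t d : ℕ) (occupied : List ℕ) : Option ℕ :=
  (List.range b).reverse.find? fun i => t + i ≤ d ∧ i ∉ occupied

/-- Put `p` into the latest possible free slot, or discard it if there is none; `placed` lists
the packets already placed, with their slots. -/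
def place (b t : ℕ) (placed : List (ℕ × Pending ι)) (p : Pending ι) : List (ℕ × Pending ι) :=
  match latestFreeSlot b t p.vdl (placed.map Prod.fst) with
  | none => placed
  | some i => (i, p) :: placed

open Classical in
/-- The optimal provisional schedule at time `t`: the chosen packets, the one at position `i` of
the list being in slot `i`. -/
def OPS (b : ℕ) (S : List (Pending ι)) (t : ℕ) : List (Pending ι) :=
  (((S.insertionSort heavierFirst).foldl (place b t) []).map Prod.snd).insertionSort earlierFirst

/-- Recompute the optimal provisional schedule, drop all other packets, and set the virtual
deadline of the packet in slot `i` to `t + i`. -/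
def recompute (b t : ℕ) (S : List (Pending ι)) : List (Pending ι) :=
  (OPS b S t).mapIdx fun i q => { q with vdl := t + i }

/-- Arrivals are considered one by one, each with its real deadline as its initial virtual
deadline; in a step without arrivals the schedule is recomputed for the queue alone. -/
def meAdmit (b t : ℕ) (Q : List (Pending ι)) : List (ι × Packet) → List (Pending ι)
  | [] => recompute b t Q
  | a :: as =>
    (a :: as).foldl (fun Q' p => recompute b t (Q' ++ [⟨p.1, p.2, p.2.deadline⟩])) Q

/-- Let `e` be the packet with the earliest virtual deadline and `h` the packet with the maximum
value (the queue is in order of virtual deadlines, and `List.argmax` returns the first maximum, so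
that ties are broken in favor of the earliest virtual deadline). Send `e` if `w_e ≥ w_h / α`, and
`h` otherwise. -/
def meSelect (α : ℝ≥0) (Q : List (Pending ι)) : Option (Pending ι) :=
  match Q.argmin Pending.vdl, Q.argmax (fun q => q.packet.value) with
  | some e, some h => if h.packet.value / α ≤ e.packet.value then some e else some h
  | _, _ => none

/-- The algorithm ME with parameter `α` for a queue of capacity `b`. -/
def ME (b : ℕ) (α : ℝ≥0) : MemorylessAlgorithm ι where
  accept t Q new := meAdmit b t Q new
  select _ Q := meSelect α Q

end BoundedQueue

end

/-!
# ME with `α = 2` is strictly 3-competitive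

Fix a threshold `θ` and call a packet heavy if its value is at least `θ`. Since the value of a packet
is the integral over `θ` of the indicator of being heavy, it suffices to bound, for each `θ`, the
number of heavy packets sent by the offline schedule (`sum_le_sum_of_countP_le`). Let `e` and `h` be
as in the definition of ME. A step that sends `e` is given the two payments `w_e` and `w_h`, a step
that sends `h` is given `w_e` and `w_h` twice. As `w_h ≤ 2 w_e` in the first case and `2 w_e < w_h` in
the second, the payments of a step are at most three times its gain (`sum_payments_le`). So the claim
is that for every `θ` there are at least as many payments `≥ θ` as heavy packets sent by the offline
schedule (`card_le_paidCount`).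

At time `t`, let `P` be the set of heavy packets that the offline schedule stores and is going to send,
`j` in step `τ j`, and let `G` be the set of heavy packets in the queue of ME with virtual deadline at
least `t`. The invariant (`Balance`) is that the number of arrived heavy packets which the offline
schedule sends at some time, minus the number of payments `≥ θ`, is at most
`min |P| |G| + max_{y ≥ t} (#{j ∈ P : τ j < y} + #{q ∈ G : vdl q < y} - (y - t))`.

Arrivals preserve it (`Balance.recompute`, `Balance.arrive`). The placement is the greedy algorithm of
a transversal matroid and treats the heavy packets first, so no `#{q ∈ G : vdl q < y}` ever decreases
(`heavyCount_le_recompute`). Let `p` be an arriving heavy packet that the offline schedule sends, and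
suppose that `G` does not grow (`heavyCount_recompute_append`). If for some `z > d_p` all slots before
time `z` are filled with heavy packets, then the maximum is attained for some `y ≥ z > τ p` and grows
with `P`. Otherwise the whole queue is filled with heavy packets; then the minimum is `|P|`, because the
offline schedule stores at most `b` packets, and it grows.

The delivery preserves it (`Balance.deliver`). The surpluses with `y > t` gain one because `t` advances;
against this, `P` loses at most one packet, in the minimum and in the maximum. If ME sends `e`, then `G` loses at most the packet
`e`, so the bound decreases by at most 2, and by at most 1 if `e` is not heavy. If ME sends `h`, then `G`
loses `e` and `h`, since the virtual deadline `t` of `e` passes, so the bound decreases by at most 4, and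
by at most 2 if `e` is not heavy. These are the numbers of payments `≥ θ`. If `h` is not heavy, then
`G` is empty and the bound is zero. At the end `P` is empty, and so is the surplus.
-/

open scoped NNReal

noncomputable section

namespace BoundedQueue

variable {ι : Type}

/-! ### Counting in lists -/

theorem countP_le_add_of_imp_or {α : Type*} {p q r : α → Bool} {l : List α}
    (h : ∀ x ∈ l, r x → p x ∨ q x) : l.countP r ≤ l.countP p + l.countP q := by
  induction l with
  | nil => simp
  | cons a l ih =>
    have h1 := ih fun x hx => h x (List.mem_cons_of_mem _ hx)
    have h2 := h a List.mem_cons_self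
    simp only [List.countP_cons]
    split_ifs <;> grind

theorem add_countP_le_of_disjoint {α : Type*} {p q r : α → Bool} {l : List α}
    (hp : ∀ x ∈ l, p x → r x ∧ ¬ q x) (hq : ∀ x ∈ l, q x → r x) :
    l.countP p + l.countP q ≤ l.countP r := by
  induction l with
  | nil => simp
  | cons a l ih =>
    have h1 := ih (fun x hx => hp x (List.mem_cons_of_mem _ hx))
      (fun x hx => hq x (List.mem_cons_of_mem _ hx))
    have h2 := hp a List.mem_cons_self
    have h3 := hq a List.mem_cons_self
    simp only [List.countP_cons]
    split_ifs <;> grind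

/-- If the first `m` elements of a list contain at least `m` elements with property `p`, then every
shorter initial segment consists of such elements only. -/
theorem countP_take_eq_of_le {α : Type*} {p : α → Bool} {l : List α} {m k : ℕ}
    (hm : m ≤ (l.take m).countP p) (hk : k ≤ m) : (l.take k).countP p = k := by
  have hlen : (l.take m).length = m :=
    le_antisymm (List.length_take_le _ _) (hm.trans List.countP_le_length)
  have hall : ∀ x ∈ l.take m, p x := List.countP_eq_length.mp
    (le_antisymm List.countP_le_length (by omega))
  have hsub : ∀ x ∈ l.take k, p x := fun x hx => hall x ((List.take_subset_take_left l hk) hx)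
  rw [List.countP_eq_length.mpr hsub, List.length_take]
  rw [List.length_take] at hlen
  omega

theorem length_le_of_nodup_of_lt {l : List ℕ} {k : ℕ} (hl : l.Nodup) (h : ∀ i ∈ l, i < k) :
    l.length ≤ k := by
  have := (List.subperm_of_subset hl (l₂ := List.range k)
    (fun i hi => List.mem_range.mpr (h i hi))).length_le
  simpa using this

/-! ### Placing packets into slots -/

theorem latestFreeSlot_eq_some {b t d i : ℕ} {occ : List ℕ}
    (h : latestFreeSlot b t d occ = some i) :
    i < b ∧ t + i ≤ d ∧ i ∉ occ ∧ ∀ k < b, t + k ≤ d → k ∉ occ → k ≤ i := by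
  unfold latestFreeSlot at h
  obtain ⟨hi, as, bs, hl, has⟩ := List.find?_eq_some_iff_append.mp h
  simp only [decide_eq_true_eq] at hi
  have hmem : i ∈ (List.range b).reverse := by rw [hl]; simp
  refine ⟨by simpa using hmem, hi.1, hi.2, fun k hk hkd hko => ?_⟩
  have hkm : k ∈ as ++ i :: bs := by rw [← hl]; simpa using hk
  have hp : (List.range b).reverse.Pairwise (· > ·) := by
    rw [List.pairwise_reverse]; exact List.pairwise_lt_range
  rw [hl, List.pairwise_append] at hp
  rcases List.mem_append.mp hkm with hk' | hk'
  · have := has k hk'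
    simp [hkd, hko] at this
  · rcases List.mem_cons.mp hk' with rfl | hk'
    · exact le_rfl
    · exact (List.rel_of_pairwise_cons hp.2.1 hk').le

theorem latestFreeSlot_eq_none {b t d : ℕ} {occ : List ℕ}
    (h : latestFreeSlot b t d occ = none) : ∀ k < b, t + k ≤ d → k ∈ occ := by
  unfold latestFreeSlot at h
  rw [List.find?_eq_none] at h
  intro k hk hkd
  have := h k (by simpa using hk)
  simpa [hkd] using this

/-- Either `p` is discarded because all slots it could use are occupied, or it is put into the
latest of the free ones. -/
theorem place_cases (b t : ℕ) (pl : List (ℕ × Pending ι)) (p : Pending ι) :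
    (place b t pl p = pl ∧ ∀ k < b, t + k ≤ p.vdl → k ∈ pl.map Prod.fst) ∨
    ∃ i, place b t pl p = (i, p) :: pl ∧ i < b ∧ t + i ≤ p.vdl ∧ i ∉ pl.map Prod.fst ∧
      ∀ k < b, t + k ≤ p.vdl → k ∉ pl.map Prod.fst → k ≤ i := by
  unfold place
  cases h : latestFreeSlot b t p.vdl (pl.map Prod.fst) with
  | none => exact Or.inl ⟨rfl, latestFreeSlot_eq_none h⟩
  | some i => exact Or.inr ⟨i, rfl, latestFreeSlot_eq_some h⟩

/-- The placed packets are packets of the input in distinct slots, none of them after its virtual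
deadline. -/
structure IsPlacement (b t : ℕ) (S : List (Pending ι)) (pl : List (ℕ × Pending ι)) : Prop where
  nodup : (pl.map Prod.fst).Nodup
  lt : ∀ x ∈ pl, x.1 < b
  le_vdl : ∀ x ∈ pl, t + x.1 ≤ x.2.vdl
  subperm : (pl.map Prod.snd).Subperm S

theorem IsPlacement.place {b t : ℕ} {S : List (Pending ι)} {pl : List (ℕ × Pending ι)}
    (h : IsPlacement b t S pl) (p : Pending ι) :
    IsPlacement b t (S ++ [p]) (place b t pl p) := by
  rcases place_cases b t pl p with ⟨h1, -⟩ | ⟨i, h1, h2, h3, h4, -⟩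
  · rw [h1]
    exact ⟨h.nodup, h.lt, h.le_vdl, h.subperm.trans (List.sublist_append_left S [p]).subperm⟩
  · rw [h1]
    refine ⟨List.nodup_cons.mpr ⟨h4, h.nodup⟩, ?_, ?_, ?_⟩
    · rintro x (_ | ⟨_, hx⟩); exacts [h2, h.lt x hx]
    · rintro x (_ | ⟨_, hx⟩); exacts [h3, h.le_vdl x hx]
    · exact ((List.subperm_cons p).mpr h.subperm).trans (List.perm_append_comm (l₁ := [p])).subperm

theorem isPlacement_foldl (b t : ℕ) (S : List (Pending ι)) :
    IsPlacement b t S (S.foldl (place b t) []) := by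
  induction S using List.reverseRecOn with
  | nil => exact ⟨by simp, by simp, by simp, by simp⟩
  | append_singleton S p ih =>
    rw [List.foldl_append]
    exact ih.place p

theorem suffix_foldl_place (b t : ℕ) (S : List (Pending ι)) (pl : List (ℕ × Pending ι)) :
    pl <:+ S.foldl (place b t) pl := by
  induction S generalizing pl with
  | nil => exact List.suffix_rfl
  | cons p S ih =>
    rw [List.foldl_cons]
    refine List.IsSuffix.trans ?_ (ih _)
    rcases place_cases b t pl p with ⟨h1, -⟩ | ⟨i, h1, -⟩ <;> rw [h1]
    exact List.suffix_cons _ _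

/-- A slot `m` that is free at the end was free all the time. Hence every packet that could have
used it was placed, and in a later slot. -/
theorem foldl_place_of_free {b t m : ℕ} (hm : m < b) (S : List (Pending ι))
    (hfree : m ∉ (S.foldl (place b t) []).map Prod.fst) :
    (∀ x ∈ S.foldl (place b t) [], t + m ≤ x.2.vdl → m < x.1) ∧
    ∀ f : Pending ι → Bool, (∀ q, f q → t + m ≤ q.vdl) →
      S.countP f ≤ ((S.foldl (place b t) []).map Prod.snd).countP f := by
  induction S using List.reverseRecOn with
  | nil => simp
  | append_singleton S p ih =>
    rw [List.foldl_append, List.foldl_cons, List.foldl_nil] at hfree ⊢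
    rcases place_cases b t (S.foldl (place b t) []) p with ⟨h1, h2⟩ | ⟨i, h1, h2, h3, h4, h5⟩
    · rw [h1] at hfree ⊢
      obtain ⟨ih1, ih2⟩ := ih hfree
      refine ⟨ih1, fun f hf => ?_⟩
      have hp : ¬ f p := fun hp => hfree (h2 m hm (hf p hp))
      have := ih2 f hf
      simp [List.countP_append, hp] at this ⊢
      exact this
    · rw [h1] at hfree ⊢
      rw [List.map_cons, List.mem_cons, not_or] at hfree
      obtain ⟨ih1, ih2⟩ := ih hfree.2
      constructor
      · rintro x (_ | ⟨_, hx⟩) hxm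
        · exact lt_of_le_of_ne (h5 m hm hxm hfree.2) hfree.1
        · exact ih1 x hx hxm
      · intro f hf
        have := ih2 f hf
        rw [List.countP_append, List.map_cons, List.countP_cons, List.countP_cons, List.countP_nil]
        dsimp only
        omega

/-- The matroid structure behind the placement: either all slots are occupied, or, `m` being the
first free slot, the slots before `m` are occupied by packets with virtual deadline before `t + m`,
and no packet with a later one is discarded. Here `f` serves to count with multiplicity. -/
theorem exists_tight_foldl_place (b t : ℕ) (S : List (Pending ι)) :
    b ≤ ((S.foldl (place b t) []).map Prod.snd).length ∨
    ∃ m < b, m ≤ ((S.foldl (place b t) []).map Prod.snd).countP (fun q => q.vdl < t + m) ∧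
      ∀ f : Pending ι → Bool, (∀ q, f q → t + m ≤ q.vdl) →
        S.countP f ≤ ((S.foldl (place b t) []).map Prod.snd).countP f := by
  set pl := S.foldl (place b t) [] with hpl
  by_cases hfull : ∀ i < b, i ∈ pl.map Prod.fst
  · left
    have := (List.subperm_of_subset (List.nodup_range (n := b)) (l₂ := pl.map Prod.fst)
      (fun i hi => hfull i (List.mem_range.mp hi))).length_le
    simpa using this
  · right
    push Not at hfull
    classical
    have hex : ∃ i, i < b ∧ i ∉ pl.map Prod.fst := hfull
    obtain ⟨hmb, hmfree⟩ := Nat.find_spec hex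
    set m := Nat.find hex with hmdef
    have hocc : ∀ i < m, i ∈ pl.map Prod.fst := fun i hi => by
      by_contra hc
      exact Nat.find_min hex hi ⟨hi.trans hmb, hc⟩
    obtain ⟨h1, h2⟩ := foldl_place_of_free hmb S hmfree
    refine ⟨m, hmb, ?_, h2⟩
    have hsub : (List.range m).Subperm ((pl.filter fun x => x.2.vdl < t + m).map Prod.fst) := by
      refine List.subperm_of_subset List.nodup_range fun i hi => ?_
      rw [List.mem_range] at hi
      obtain ⟨x, hx, rfl⟩ := List.mem_map.mp (hocc i hi)
      refine List.mem_map.mpr ⟨x, List.mem_filter.mpr ⟨hx, ?_⟩, rfl⟩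
      by_contra hc
      have := h1 x hx (by simpa using hc)
      omega
    have := hsub.length_le
    rw [List.length_range, List.length_map, ← List.countP_eq_length_filter] at this
    rw [List.countP_map]
    exact this

/-! ### The optimal provisional schedule -/

instance : Std.Total (heavierFirst (ι := ι)) where
  total p q := by
    unfold heavierFirst
    rcases lt_trichotomy p.packet.value q.packet.value with h | h | h
    · exact Or.inr (Or.inl h)
    · rcases le_total p.vdl q.vdl with h' | h'
      · exact Or.inr (Or.inr ⟨h.symm, h'⟩)
      · exact Or.inl (Or.inr ⟨h, h'⟩)
    · exact Or.inl (Or.inl h)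

instance : IsTrans (Pending ι) heavierFirst where
  trans p q r := by
    unfold heavierFirst
    rintro (h | ⟨h, h'⟩) (k | ⟨k, k'⟩)
    · exact Or.inl (k.trans h)
    · exact Or.inl (k ▸ h)
    · exact Or.inl (h ▸ k)
    · exact Or.inr ⟨h.trans k, k'.trans h'⟩

instance : Std.Total (earlierFirst (ι := ι)) where
  total p q := by
    unfold earlierFirst
    rcases lt_trichotomy p.vdl q.vdl with h | h | h
    · exact Or.inl (Or.inl h)
    · rcases le_total p.packet.value q.packet.value with h' | h'
      · exact Or.inr (Or.inr ⟨h.symm, h'⟩)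
      · exact Or.inl (Or.inr ⟨h, h'⟩)
    · exact Or.inr (Or.inl h)

instance : IsTrans (Pending ι) earlierFirst where
  trans p q r := by
    unfold earlierFirst
    rintro (h | ⟨h, h'⟩) (k | ⟨k, k'⟩)
    · exact Or.inl (h.trans k)
    · exact Or.inl (k ▸ h)
    · exact Or.inl (h ▸ k)
    · exact Or.inr ⟨h.trans k, k'.trans h'⟩

/-- In order of non-increasing value the packets of value at least `θ` come first. -/
theorem exists_append_of_pairwise_heavierFirst (θ : ℝ≥0) {S : List (Pending ι)}
    (hS : S.Pairwise heavierFirst) :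
    ∃ A B, S = A ++ B ∧ (∀ q ∈ A, θ ≤ q.packet.value) ∧ ∀ q ∈ B, q.packet.value < θ := by
  induction S with
  | nil => exact ⟨[], [], rfl, by simp, by simp⟩
  | cons p S ih =>
    obtain ⟨A, B, rfl, hA, hB⟩ := ih hS.of_cons
    by_cases hp : θ ≤ p.packet.value
    · exact ⟨p :: A, B, rfl, by simpa [hp] using hA, hB⟩
    · refine ⟨[], p :: (A ++ B), rfl, by simp, ?_⟩
      push Not at hp
      rintro q (_ | ⟨_, hq⟩)
      · exact hp
      · rcases List.rel_of_pairwise_cons hS hq with h | h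
        · exact h.trans hp
        · exact h.1 ▸ hp

/-- There are at most `x - t` chosen packets with virtual deadline before `x`, and none has a
virtual deadline before `t`. -/
theorem OPS_feasible (b t : ℕ) (S : List (Pending ι)) :
    (OPS b S t).length ≤ b ∧ (OPS b S t).Subperm S ∧ (∀ q ∈ OPS b S t, t ≤ q.vdl) ∧
      ∀ x, (OPS b S t).countP (fun q => q.vdl < x) ≤ x - t := by
  classical
  unfold OPS
  set pl := (S.insertionSort heavierFirst).foldl (place b t) [] with hpl
  have h : IsPlacement b t _ pl := isPlacement_foldl b t _
  have hperm := List.perm_insertionSort earlierFirst (pl.map Prod.snd)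
  refine ⟨?_, ?_, ?_, ?_⟩
  · rw [hperm.length_eq, List.length_map, ← List.length_map (f := Prod.fst)]
    refine length_le_of_nodup_of_lt h.nodup fun i hi => ?_
    obtain ⟨x, hx, rfl⟩ := List.mem_map.mp hi
    exact h.lt x hx
  · exact hperm.subperm.trans (h.subperm.trans (List.perm_insertionSort _ _).subperm)
  · intro q hq
    obtain ⟨x, hx, rfl⟩ := List.mem_map.mp (hperm.mem_iff.mp hq)
    have := h.le_vdl x hx
    omega
  · intro x
    rw [hperm.countP_eq, List.countP_map, List.countP_eq_length_filter,
      ← List.length_map (f := Prod.fst)]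
    refine length_le_of_nodup_of_lt (h.nodup.sublist (List.filter_sublist.map _)) fun i hi => ?_
    obtain ⟨y, hy, rfl⟩ := List.mem_map.mp hi
    obtain ⟨hy1, hy2⟩ := List.mem_filter.mp hy
    have := h.le_vdl y hy1
    simp only [Function.comp_apply, decide_eq_true_eq] at hy2
    omega

/-- The greedy choice is optimal for every value threshold `θ` at once: either the queue is full of
packets of value at least `θ`, or such packets fill the first `m` slots, and no such packet with a
later virtual deadline is discarded. -/
theorem OPS_tight (θ : ℝ≥0) (b t : ℕ) (S : List (Pending ι)) :
    b ≤ (OPS b S t).countP (fun q => θ ≤ q.packet.value) ∨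
    ∃ m < b, m ≤ (OPS b S t).countP (fun q => θ ≤ q.packet.value ∧ q.vdl < t + m) ∧
      ∀ f : Pending ι → Bool, (∀ q, f q → θ ≤ q.packet.value ∧ t + m ≤ q.vdl) →
        S.countP f ≤ (OPS b S t).countP f := by
  classical
  obtain ⟨A, B, hAB, hA, hB⟩ := exists_append_of_pairwise_heavierFirst θ
    (List.pairwise_insertionSort heavierFirst S)
  have hOPS : (OPS b S t).Perm (((A ++ B).foldl (place b t) []).map Prod.snd) := by
    rw [← hAB]
    unfold OPS
    exact List.perm_insertionSort _ _
  rw [List.foldl_append] at hOPS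
  have hle : ∀ f : Pending ι → Bool,
      ((A.foldl (place b t) []).map Prod.snd).countP f ≤ (OPS b S t).countP f := fun f => by
    rw [hOPS.countP_eq]
    exact ((suffix_foldl_place b t B (A.foldl (place b t) [])).map Prod.snd).sublist.countP_le
  have hheavy : ∀ q ∈ (A.foldl (place b t) []).map Prod.snd, θ ≤ q.packet.value := fun q hq =>
    hA q ((isPlacement_foldl b t A).subperm.subset hq)
  rcases exists_tight_foldl_place b t A with h | ⟨m, hm, h1, h2⟩
  · left
    refine h.trans (le_trans ?_ (hle _))
    exact (List.countP_eq_length.mpr (by simpa using hheavy)).ge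
  · right
    refine ⟨m, hm, h1.trans (le_trans ?_ (hle _)), fun f hf => ?_⟩
    · refine List.countP_mono_left fun q hq hqm => ?_
      simp only [decide_eq_true_eq] at hqm ⊢
      exact ⟨hheavy q hq, hqm⟩
    · have hperm : S.Perm (A ++ B) := hAB ▸ (List.perm_insertionSort _ _).symm
      have hB0 : B.countP f = 0 := List.countP_eq_zero.mpr fun q hq hfq =>
        absurd (hf q hfq).1 (not_le.mpr (hB q hq))
      rw [hperm.countP_eq, List.countP_append, hB0, add_zero]
      exact (h2 f fun q hq => (hf q hq).2).trans (hle f)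

/-- The chosen packet at position `i` has virtual deadline at least `t + i`. -/
theorem add_le_vdl_of_OPS (b t : ℕ) (S : List (Pending ι)) (i : ℕ) (hi : i < (OPS b S t).length) :
    t + i ≤ (OPS b S t)[i].vdl := by
  classical
  obtain ⟨-, -, hge, hcount⟩ := OPS_feasible b t S
  have hs : (OPS b S t).Pairwise earlierFirst := by
    unfold OPS
    exact List.pairwise_insertionSort _ _
  set L := OPS b S t
  change t + i ≤ L[i].vdl
  have h1 : ∀ q ∈ L.take (i + 1), q.vdl < L[i].vdl + 1 := by
    intro q hq
    obtain ⟨j, hj, rfl⟩ := List.mem_iff_getElem.mp hq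
    rw [List.getElem_take]
    rw [List.length_take] at hj
    rcases Nat.lt_or_ge j i with hji | hji
    · rcases List.pairwise_iff_getElem.mp hs j i (by omega) hi hji with h | h
      · omega
      · omega
    · obtain rfl : j = i := by omega
      omega
  have h2 : (L.take (i + 1)).countP (fun q => q.vdl < L[i].vdl + 1) = i + 1 := by
    rw [List.countP_eq_length.mpr (by simpa using h1), List.length_take]
    omega
  have h3 := (List.take_sublist (i + 1) L).countP_le (p := fun q => q.vdl < L[i].vdl + 1)
  have h4 := hcount (L[i].vdl + 1)
  have h5 := hge L[i] (List.getElem_mem hi)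
  omega

/-! ### Packets above a value threshold in the recomputed queue -/

/-- The number of packets in the queue `Q` of value at least `θ` with virtual deadline in
`[t, y)`. -/
def heavyCount (θ : ℝ≥0) (t y : ℕ) (Q : List (Pending ι)) : ℕ :=
  Q.countP fun q => θ ≤ q.packet.value ∧ t ≤ q.vdl ∧ q.vdl < y

/-- The state of the queue before the arrivals of step `t`: packets of virtual deadline before `t`
may be present, and some of the time steps from `t` on need not be the virtual deadline of any
packet. -/
structure IsQueue (b t : ℕ) (Q : List (Pending ι)) : Prop where
  nodup_name : (Q.map Pending.name).Nodup
  nodup_vdl : (Q.map Pending.vdl).Nodup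
  vdl_lt : ∀ q ∈ Q, q.vdl < t + b

theorem heavyCount_mono_right {θ : ℝ≥0} {t y y' : ℕ} (h : y ≤ y') (Q : List (Pending ι)) :
    heavyCount θ t y Q ≤ heavyCount θ t y' Q := by
  refine List.countP_mono_left fun q _ => ?_
  simp only [decide_eq_true_eq]
  exact fun ⟨h1, h2, h3⟩ => ⟨h1, h2, h3.trans_le h⟩

theorem IsQueue.heavyCount_le {b t : ℕ} {Q : List (Pending ι)} (hQ : IsQueue b t Q) (θ : ℝ≥0)
    (y : ℕ) : heavyCount θ t y Q ≤ y - t := by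
  unfold heavyCount
  rw [List.countP_eq_length_filter, ← List.length_map (f := Pending.vdl)]
  have h : (List.map Pending.vdl (Q.filter fun q =>
      θ ≤ q.packet.value ∧ t ≤ q.vdl ∧ q.vdl < y)).Subperm (List.range' t (y - t)) := by
    refine List.subperm_of_subset (hQ.nodup_vdl.sublist (List.filter_sublist.map _)) fun v hv => ?_
    obtain ⟨q, hq, rfl⟩ := List.mem_map.mp hv
    have := (List.mem_filter.mp hq).2
    simp only [decide_eq_true_eq] at this
    rw [List.mem_range'_1]
    omega
  simpa using h.length_le

theorem countP_mapIdx_vdl (θ : ℝ≥0) {t s : ℕ} (hts : t ≤ s) (y : ℕ) (L : List (Pending ι)) :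
    heavyCount θ t y (L.mapIdx fun i q => { q with vdl := s + i }) =
      (L.take (y - s)).countP fun q => θ ≤ q.packet.value := by
  unfold heavyCount
  induction L generalizing s with
  | nil => simp
  | cons a L ih =>
    have ih' := ih (s := s + 1) (by omega)
    rw [List.mapIdx_cons, List.countP_cons]
    simp only [Nat.add_assoc, Nat.add_comm 1] at ih' ⊢
    rw [ih']
    by_cases hsy : s < y
    · rw [show y - s = (y - (s + 1)) + 1 by omega, List.take_succ_cons, List.countP_cons]
      simp [hsy, hts]
    · rw [show y - s = 0 by omega, show y - (s + 1) = 0 by omega]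
      simp [hsy]

theorem heavyCount_recompute (θ : ℝ≥0) (b t y : ℕ) (S : List (Pending ι)) :
    heavyCount θ t y (recompute b t S) =
      ((OPS b S t).take (y - t)).countP fun q => θ ≤ q.packet.value :=
  countP_mapIdx_vdl θ le_rfl y _

theorem map_name_recompute (b t : ℕ) (S : List (Pending ι)) :
    (recompute b t S).map Pending.name = (OPS b S t).map Pending.name := by
  refine List.ext_getElem (by simp [recompute]) fun i h1 h2 => ?_
  simp [recompute]

theorem map_vdl_recompute (b t : ℕ) (S : List (Pending ι)) :
    (recompute b t S).map Pending.vdl = List.range' t (OPS b S t).length := by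
  refine List.ext_getElem (by simp [recompute]) fun i h1 h2 => ?_
  simp [recompute]

theorem mem_recompute {b t : ℕ} {S : List (Pending ι)} {q : Pending ι}
    (hq : q ∈ recompute b t S) :
    t ≤ q.vdl ∧ ∃ q' ∈ S, q'.name = q.name ∧ q'.packet = q.packet ∧ q.vdl ≤ q'.vdl := by
  obtain ⟨i, hi, rfl⟩ := List.mem_iff_getElem.mp hq
  have hi' : i < (OPS b S t).length := by simpa [recompute] using hi
  have hmem : (OPS b S t)[i] ∈ S := (OPS_feasible b t S).2.1.subset (List.getElem_mem hi')
  have := add_le_vdl_of_OPS b t S i hi'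
  simp only [recompute, List.getElem_mapIdx]
  exact ⟨by omega, _, hmem, rfl, rfl, this⟩

theorem length_recompute_le (b t : ℕ) (S : List (Pending ι)) : (recompute b t S).length ≤ b := by
  simpa [recompute] using (OPS_feasible b t S).1

theorem nodup_name_recompute (b t : ℕ) {S : List (Pending ι)} (hS : (S.map Pending.name).Nodup) :
    ((recompute b t S).map Pending.name).Nodup := by
  rw [map_name_recompute]
  obtain ⟨l, hl, hlS⟩ := (OPS_feasible b t S).2.1
  exact ((hl.map Pending.name).nodup_iff).mp (hS.sublist (hlS.map _))

/-- `OPS_tight` in terms of the new virtual deadlines: the heavy packets fill all slots before `m`,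
and if `m < b`, then no heavy packet with old virtual deadline at least `t + m` is lost. -/
theorem exists_tight_recompute (θ : ℝ≥0) (b t : ℕ) (S : List (Pending ι)) :
    ∃ m ≤ b, (∀ y, t ≤ y → y ≤ t + m → y - t ≤ heavyCount θ t y (recompute b t S)) ∧
      (m < b → ∀ y, t + m ≤ y →
        m + S.countP (fun q => θ ≤ q.packet.value ∧ t + m ≤ q.vdl ∧ q.vdl < y) ≤
          heavyCount θ t y (recompute b t S)) := by
  obtain ⟨hlen, -, -, -⟩ := OPS_feasible b t S
  -- a chosen packet with virtual deadline before `t + k` has position less than `k`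
  have hpos : ∀ (f : Pending ι → Bool) (k : ℕ), (∀ q, f q → q.vdl < t + k) →
      (OPS b S t).countP f ≤ ((OPS b S t).take k).countP f := by
    intro f k hf
    conv_lhs => rw [← List.take_append_drop k (OPS b S t), List.countP_append]
    have : ((OPS b S t).drop k).countP f = 0 := by
      refine List.countP_eq_zero.mpr fun q hq hfq => ?_
      obtain ⟨i, hi, rfl⟩ := List.mem_iff_getElem.mp hq
      have h1 := hf _ hfq
      rw [List.getElem_drop] at h1
      have h2 := add_le_vdl_of_OPS b t S (k + i) (by rw [List.length_drop] at hi; omega)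
      omega
    omega
  have hfill : ∀ m, m ≤ ((OPS b S t).take m).countP (fun q => θ ≤ q.packet.value) →
      ∀ y, t ≤ y → y ≤ t + m → y - t ≤ heavyCount θ t y (recompute b t S) := by
    intro m hm y hty hym
    rw [heavyCount_recompute]
    exact (countP_take_eq_of_le hm (by omega)).ge
  rcases OPS_tight θ b t S with h | ⟨m, hmb, h1, h2⟩
  · refine ⟨b, le_rfl, hfill b ?_, fun h => absurd h (lt_irrefl b)⟩
    rwa [List.take_of_length_le hlen]
  · refine ⟨m, hmb.le, hfill m ?_, fun _ y hy => ?_⟩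
    · refine h1.trans ((hpos _ m fun q hq => ?_).trans (List.countP_mono_left fun q _ hq => ?_))
      · simp only [decide_eq_true_eq] at hq; exact hq.2
      · simp only [decide_eq_true_eq] at hq ⊢; exact hq.1
    · rw [heavyCount_recompute]
      have h3 := h2 (fun q => θ ≤ q.packet.value ∧ t + m ≤ q.vdl ∧ q.vdl < y) (fun q hq => by
        simp only [decide_eq_true_eq] at hq; exact ⟨hq.1, hq.2.1⟩)
      have h4 := add_countP_le_of_disjoint (l := OPS b S t)
        (p := fun q => θ ≤ q.packet.value ∧ q.vdl < t + m)
        (q := fun q => θ ≤ q.packet.value ∧ t + m ≤ q.vdl ∧ q.vdl < y)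
        (r := fun q => θ ≤ q.packet.value ∧ q.vdl < t + (y - t))
        (fun q _ hq => by
          simp only [decide_eq_true_eq] at hq ⊢
          exact ⟨⟨hq.1, by omega⟩, fun h => by omega⟩)
        (fun q _ hq => by
          simp only [decide_eq_true_eq] at hq ⊢
          exact ⟨hq.1, by omega⟩)
      have h5 := hpos (fun q => θ ≤ q.packet.value ∧ q.vdl < t + (y - t)) (y - t) (fun q hq => by
        simp only [decide_eq_true_eq] at hq; exact hq.2)
      have h6 : ((OPS b S t).take (y - t)).countP
            (fun q => θ ≤ q.packet.value ∧ q.vdl < t + (y - t)) ≤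
          ((OPS b S t).take (y - t)).countP (fun q => θ ≤ q.packet.value) :=
        List.countP_mono_left fun q _ hq => by
          simp only [decide_eq_true_eq] at hq ⊢; exact hq.1
      omega

theorem heavyCount_le_add (θ : ℝ≥0) (t z y : ℕ) (Q : List (Pending ι)) :
    heavyCount θ t y Q ≤ heavyCount θ t z Q + heavyCount θ z y Q := by
  refine countP_le_add_of_imp_or fun q _ hq => ?_
  simp only [decide_eq_true_eq] at hq ⊢
  rcases Nat.lt_or_ge q.vdl z with h | h
  · exact Or.inl ⟨hq.1, hq.2.1, h⟩
  · exact Or.inr ⟨hq.1, h, hq.2.2⟩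

/-- Recomputing the schedule never decreases the number of heavy packets with virtual deadline
before `y`, whether or not a packet arrives. -/
theorem heavyCount_le_recompute {b t : ℕ} {Q S : List (Pending ι)} (hQ : IsQueue b t Q)
    (hS : Q.Sublist S) (θ : ℝ≥0) (y : ℕ) :
    heavyCount θ t y Q ≤ heavyCount θ t y (recompute b t S) := by
  obtain ⟨m, hmb, h1, h2⟩ := exists_tight_recompute θ b t S
  have hle := hQ.heavyCount_le θ
  rcases Nat.lt_or_ge y t with hy | hy
  · have := hle y
    omega
  rcases Nat.le_or_le y (t + m) with hym | hym
  · exact (hle y).trans (h1 y hy hym)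
  rcases hmb.lt_or_eq with hmb | rfl
  · have h3 := h2 hmb y hym
    have h4 : heavyCount θ (t + m) y Q ≤
        S.countP (fun q => θ ≤ q.packet.value ∧ t + m ≤ q.vdl ∧ q.vdl < y) := hS.countP_le
    have h5 := heavyCount_le_add θ t (t + m) y Q
    have h6 := hle (t + m)
    omega
  · have h3 : heavyCount θ t y Q ≤ heavyCount θ t (t + m) Q :=
      List.countP_mono_left fun q hq => by
        simp only [decide_eq_true_eq]
        exact fun h => ⟨h.1, h.2.1, hQ.vdl_lt q hq⟩
    have h4 := h1 (t + m) (by omega) le_rfl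
    have h5 := hle (t + m)
    have h6 := heavyCount_mono_right (θ := θ) (t := t) hym (recompute m t S)
    omega

/-- The arrival of a heavy packet `p` increases the number of heavy packets in the queue, or the
slots up to the deadline of `p` are all filled with heavy packets, or the whole queue is. -/
theorem heavyCount_recompute_append {b t : ℕ} {Q : List (Pending ι)} (hQ : IsQueue b t Q)
    {θ : ℝ≥0} {p : Pending ι} (hp : θ ≤ p.packet.value) :
    heavyCount θ t (t + b) Q + 1 ≤ heavyCount θ t (t + b) (recompute b t (Q ++ [p])) ∨
    (∃ z, p.vdl < z ∧ t ≤ z ∧ z - t ≤ heavyCount θ t z (recompute b t (Q ++ [p]))) ∨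
    b ≤ heavyCount θ t (t + b) (recompute b t (Q ++ [p])) := by
  obtain ⟨m, hmb, h1, h2⟩ := exists_tight_recompute θ b t (Q ++ [p])
  rcases hmb.lt_or_eq with hmb | rfl
  · rcases Nat.lt_or_ge p.vdl (t + m) with h | h
    · exact Or.inr (Or.inl ⟨t + m, h, by omega, h1 _ (by omega) le_rfl⟩)
    · left
      set y := max (t + b) (p.vdl + 1) with hy
      have h3 := h2 hmb y (by omega)
      rw [List.countP_append, List.countP_singleton,
        if_pos (by simpa using ⟨hp, h, by omega⟩)] at h3
      have h4 := heavyCount_le_add θ t (t + m) y Q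
      have h5 := hQ.heavyCount_le θ (t + m)
      have h6 : heavyCount θ t (t + b) Q ≤ heavyCount θ t y Q :=
        heavyCount_mono_right (by omega) Q
      have h7 : heavyCount θ t y (recompute b t (Q ++ [p])) ≤
          heavyCount θ t (t + b) (recompute b t (Q ++ [p])) := by
        rw [heavyCount_recompute, heavyCount_recompute,
          List.take_of_length_le (i := t + b - t)
            (by rw [Nat.add_sub_cancel_left]; exact (OPS_feasible b t _).1)]
        exact (List.take_sublist _ _).countP_le
      have h8 : heavyCount θ (t + m) y Q =
        Q.countP (fun q => θ ≤ q.packet.value ∧ t + m ≤ q.vdl ∧ q.vdl < y) := rfl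
      omega
  · right; right
    have := h1 (t + m) (by omega) le_rfl
    omega

/-! ### The balance between the offline schedule and the queue -/

/-- For a threshold `θ`, let `A` be the set of those packets of value at least `θ` sent by an offline
schedule that have arrived so far, `j` being sent in step `τ j`. Their number exceeds the number of
`paid` units by at most the smaller of the number of packets of `A` that are still to be sent and
the number of heavy packets in `Q`, plus, for some `y`, the surplus of the packets of both kinds
due before `y` over the number of time steps from `t` to `y`. -/
def Balance (θ : ℝ≥0) (b t : ℕ) (τ : ι → ℕ) (A : Finset ι) (paid : ℕ)
    (Q : List (Pending ι)) : Prop :=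
  ∃ y, t ≤ y ∧ A.card + y ≤
    paid + min ((A.filter fun j => t ≤ τ j).card) (heavyCount θ t (t + b) Q) +
      (A.filter fun j => t ≤ τ j ∧ τ j < y).card + heavyCount θ t y Q + t

section
variable {θ : ℝ≥0} {b t : ℕ} {τ : ι → ℕ} {A : Finset ι} {paid : ℕ} {Q : List (Pending ι)}

theorem Balance.recompute {S : List (Pending ι)} (h : Balance θ b t τ A paid Q)
    (hQ : IsQueue b t Q) (hS : Q.Sublist S) : Balance θ b t τ A paid (recompute b t S) := by
  obtain ⟨y, hty, hy⟩ := h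
  refine ⟨y, hty, hy.trans ?_⟩
  have h1 := heavyCount_le_recompute hQ hS θ y
  have h2 := heavyCount_le_recompute hQ hS θ (t + b)
  omega

/-- The balance survives the arrival of a packet `p` that the offline schedule sends. If ME gains
no heavy packet, then either the slots up to the deadline of `p` are filled with heavy packets, so
that the surplus grows, or the whole queue is, so that the minimum is the number of packets still
to be sent by the offline schedule, which grows. -/
theorem Balance.arrive [DecidableEq ι] (h : Balance θ b t τ A paid Q) (hQ : IsQueue b t Q)
    {p : Pending ι} (hA : p.name ∉ A) (hpθ : θ ≤ p.packet.value) (htτ : t ≤ τ p.name)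
    (hτd : τ p.name ≤ p.vdl)
    (hcap : ((insert p.name A).filter fun j => t ≤ τ j).card ≤ b) :
    Balance θ b t τ (insert p.name A) paid (BoundedQueue.recompute b t (Q ++ [p])) := by
  have hins : ∀ (R : ι → Prop) [DecidablePred R], R p.name →
      ((insert p.name A).filter R).card = (A.filter R).card + 1 := by
    intro R _ hR
    rw [Finset.filter_insert, if_pos hR, Finset.card_insert_of_notMem (by simp [hA])]
  have hmono : ∀ y, (A.filter fun j => t ≤ τ j ∧ τ j < y).card ≤
      ((insert p.name A).filter fun j => t ≤ τ j ∧ τ j < y).card := fun y =>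
    Finset.card_le_card (Finset.filter_subset_filter _ (Finset.subset_insert _ _))
  have hO := Finset.card_insert_of_notMem hA
  have hP := hins (fun j => t ≤ τ j) htτ
  obtain ⟨y, hty, hy⟩ := h
  have hg := heavyCount_le_recompute hQ (List.sublist_append_left Q [p]) θ
  have hgy := hg y
  have hgb := hg (t + b)
  have hmy := hmono y
  rcases heavyCount_recompute_append hQ hpθ with h1 | ⟨z, hpz, htz, h1⟩ | h1
  · exact ⟨y, hty, by omega⟩
  · rcases Nat.le_or_le z y with hzy | hzy
    · have hT := hins (fun j => t ≤ τ j ∧ τ j < y) ⟨htτ, by omega⟩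
      exact ⟨y, hty, by omega⟩
    · -- below `z` the queue has no free slot, so the surplus is largest for `z` or beyond
      have hT := hins (fun j => t ≤ τ j ∧ τ j < z) ⟨htτ, by omega⟩
      have hT' : (A.filter fun j => t ≤ τ j ∧ τ j < y).card ≤
          (A.filter fun j => t ≤ τ j ∧ τ j < z).card :=
        Finset.card_le_card (Finset.monotone_filter_right _ fun j _ hj =>
          ⟨hj.1, hj.2.trans_le hzy⟩)
      have hq := hQ.heavyCount_le θ y
      exact ⟨z, htz, by omega⟩
  · exact ⟨y, hty, by omega⟩

end

/-! ### The delivery -/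

/-- Values that pay for a delivery step with queue `Q`: those of `e` and `h` if `e` is sent, and
each of them twice if `h` is sent. In both cases their sum is at most three times the value of the
packet sent. -/
def payments (Q : List (Pending ι)) : List ℝ≥0 :=
  match Q.argmin Pending.vdl, Q.argmax (fun q => q.packet.value) with
  | some e, some h =>
    if h.packet.value / 2 ≤ e.packet.value then [e.packet.value, h.packet.value]
    else [e.packet.value, e.packet.value, h.packet.value, h.packet.value]
  | _, _ => []

/-- The packets `e` and `h` of a nonempty queue. -/
theorem exists_argmin_argmax {Q : List (Pending ι)} (hQ : Q ≠ []) :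
    ∃ e h, Q.argmin Pending.vdl = some e ∧ Q.argmax (fun q => q.packet.value) = some h ∧
      e ∈ Q ∧ h ∈ Q ∧ (∀ q ∈ Q, e.vdl ≤ q.vdl) ∧ ∀ q ∈ Q, q.packet.value ≤ h.packet.value := by
  cases h1 : Q.argmin Pending.vdl with
  | none => exact absurd (List.argmin_eq_none.mp h1) hQ
  | some e =>
    cases h2 : Q.argmax (fun q => q.packet.value) with
    | none => exact absurd (List.argmax_eq_none.mp h2) hQ
    | some h =>
      exact ⟨e, h, rfl, rfl, List.argmin_mem h1, List.argmax_mem h2,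
        fun q hq => List.le_of_mem_argmin hq h1, fun q hq => List.le_of_mem_argmax (f := fun q : Pending ι => q.packet.value) hq h2⟩

theorem meSelect_mem {α : ℝ≥0} {Q : List (Pending ι)} {s : Pending ι}
    (hs : meSelect α Q = some s) : s ∈ Q := by
  rcases eq_or_ne Q [] with rfl | hQ
  · simp [meSelect] at hs
  · obtain ⟨e, h, h1, h2, he, hh, -⟩ := exists_argmin_argmax hQ
    simp only [meSelect, h1, h2] at hs
    split_ifs at hs <;> cases hs <;> assumption

theorem sum_payments_le (Q : List (Pending ι)) :
    (payments Q).sum ≤ 3 * ((meSelect 2 Q).elim 0 fun s => s.packet.value) := by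
  rcases eq_or_ne Q [] with rfl | hQ
  · simp [payments]
  · obtain ⟨e, h, h1, h2, he, hh, -⟩ := exists_argmin_argmax hQ
    simp only [payments, meSelect, h1, h2]
    split_ifs with hlt
    · simp only [List.sum_cons, List.sum_nil, Option.elim_some]
      rw [div_le_iff₀ (by norm_num)] at hlt
      rw [← NNReal.coe_le_coe] at hlt ⊢
      push_cast at hlt ⊢
      linarith
    · simp only [List.sum_cons, List.sum_nil, Option.elim_some]
      rw [not_le, lt_div_iff₀ (by norm_num)] at hlt
      rw [← NNReal.coe_lt_coe] at hlt
      rw [← NNReal.coe_le_coe]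
      push_cast at hlt ⊢
      linarith

/-- The queue after the recomputation: the virtual deadlines are `t, t + 1, …` -/
structure IsCompact (b t : ℕ) (Q : List (Pending ι)) : Prop extends IsQueue b t Q where
  map_vdl : ∃ k, Q.map Pending.vdl = List.range' t k

theorem isCompact_recompute (b t : ℕ) {S : List (Pending ι)}
    (hS : (S.map Pending.name).Nodup) : IsCompact b t (recompute b t S) := by
  refine ⟨⟨nodup_name_recompute b t hS, ?_, fun q hq => ?_⟩, _, map_vdl_recompute b t S⟩
  · rw [map_vdl_recompute]; exact List.nodup_range'
  · have h := List.mem_map_of_mem (f := Pending.vdl) hq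
    rw [map_vdl_recompute, List.mem_range'_1] at h
    have := (OPS_feasible b t S).1
    omega

theorem IsCompact.vdl_eq {b t : ℕ} {Q : List (Pending ι)} (hQ : IsCompact b t Q) {e : Pending ι}
    (he : e ∈ Q) (hmin : ∀ q ∈ Q, e.vdl ≤ q.vdl) : e.vdl = t := by
  obtain ⟨k, hk⟩ := hQ.map_vdl
  have h1 : e.vdl ∈ List.range' t k := hk ▸ List.mem_map_of_mem he
  rw [List.mem_range'_1] at h1
  have h2 : t ∈ Q.map Pending.vdl := by rw [hk, List.mem_range'_1]; omega
  obtain ⟨q, hq, hqt⟩ := List.mem_map.mp h2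
  have := hmin q hq
  omega

theorem heavyCount_succ_le {b t : ℕ} {Q : List (Pending ι)} (hQ : IsCompact b t Q) {e : Pending ι}
    (he : e ∈ Q) (hmin : ∀ q ∈ Q, e.vdl ≤ q.vdl) (θ : ℝ≥0) :
    heavyCount θ t (t + 1) Q ≤ if θ ≤ e.packet.value then 1 else 0 := by
  have het := hQ.vdl_eq he hmin
  split_ifs with hθ
  · have := hQ.heavyCount_le θ (t + 1)
    omega
  · refine (List.countP_eq_zero.mpr fun q hq hqθ => hθ ?_).le
    simp only [decide_eq_true_eq] at hqθ
    have hqe : q = e := List.inj_on_of_nodup_map hQ.nodup_vdl hq he (by omega)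
    exact hqe ▸ hqθ.1

theorem heavyCount_filter_of_first [DecidableEq ι] {b t : ℕ} {Q : List (Pending ι)}
    (hQ : IsCompact b t Q) {e : Pending ι} (he : e ∈ Q) (hmin : ∀ q ∈ Q, e.vdl ≤ q.vdl)
    (θ : ℝ≥0) (y : ℕ) :
    heavyCount θ t y Q ≤ (if θ ≤ e.packet.value then 1 else 0) +
      heavyCount θ (t + 1) y (Q.filter fun q => q.name ≠ e.name) := by
  have h1 := heavyCount_succ_le hQ he hmin θ
  have h2 := heavyCount_le_add θ t (t + 1) y Q
  have h3 : heavyCount θ (t + 1) y Q ≤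
      heavyCount θ (t + 1) y (Q.filter fun q => q.name ≠ e.name) := by
    unfold heavyCount
    rw [List.countP_filter]
    refine List.countP_mono_left fun q hq hqy => ?_
    simp only [decide_eq_true_eq, Bool.and_eq_true] at hqy ⊢
    refine ⟨hqy, fun hne => ?_⟩
    have hqe : q = e := List.inj_on_of_nodup_map hQ.nodup_name hq he hne
    have := hQ.vdl_eq he hmin
    rw [hqe] at hqy
    omega
  omega

theorem heavyCount_filter_of_max [DecidableEq ι] {b t : ℕ} {Q : List (Pending ι)}
    (hQ : IsCompact b t Q) {e h : Pending ι} (he : e ∈ Q) (hmin : ∀ q ∈ Q, e.vdl ≤ q.vdl)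
    (hh : h ∈ Q) (θ : ℝ≥0) (y : ℕ) :
    heavyCount θ t y Q ≤ (if θ ≤ e.packet.value then 1 else 0) +
      (if θ ≤ h.packet.value then 1 else 0) +
      heavyCount θ (t + 1) y (Q.filter fun q => q.name ≠ h.name) := by
  have h1 := heavyCount_succ_le hQ he hmin θ
  have h2 := heavyCount_le_add θ t (t + 1) y Q
  have h3 : heavyCount θ (t + 1) y Q ≤
      (Q.filter fun q => q.name = h.name ∧ θ ≤ q.packet.value).length +
      heavyCount θ (t + 1) y (Q.filter fun q => q.name ≠ h.name) := by
    unfold heavyCount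
    rw [List.countP_filter, ← List.countP_eq_length_filter]
    refine countP_le_add_of_imp_or fun q hq hqy => ?_
    simp only [decide_eq_true_eq, Bool.and_eq_true] at hqy ⊢
    by_cases hn : q.name = h.name
    · exact Or.inl ⟨hn, hqy.1⟩
    · exact Or.inr ⟨hqy, hn⟩
  have h4 : (Q.filter fun q => q.name = h.name ∧ θ ≤ q.packet.value).length ≤
      if θ ≤ h.packet.value then 1 else 0 := by
    have hmem : ∀ q ∈ Q.filter fun q => q.name = h.name ∧ θ ≤ q.packet.value,
        q = h ∧ θ ≤ h.packet.value := fun q hq => by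
      obtain ⟨hqQ, hq⟩ := List.mem_filter.mp hq
      simp only [decide_eq_true_eq] at hq
      have hqe : q = h := List.inj_on_of_nodup_map hQ.nodup_name hqQ hh hq.1
      exact ⟨hqe, hqe ▸ hq.2⟩
    split_ifs with hθ
    · have hnd : (Q.filter fun q => q.name = h.name ∧ θ ≤ q.packet.value).Nodup :=
        (List.Nodup.of_map _ hQ.nodup_name).filter _
      exact (List.subperm_of_subset hnd (l₂ := [h]) fun q hq => by
        simpa using (hmem q hq).1).length_le
    · rw [List.eq_nil_iff_forall_not_mem.mpr fun q hq => hθ (hmem q hq).2]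
      simp
  omega

/-- The balance survives the delivery step: the minimum and the surplus together lose at most as
much as there are heavy values among the payments. -/
theorem Balance.deliver {n b t : ℕ} {θ : ℝ≥0} {τ : Fin n → ℕ} {A : Finset (Fin n)} {paid : ℕ}
    {Q : List (Pending (Fin n))} (h : Balance θ b t τ A paid Q) (hQ : IsCompact b t Q)
    (hτ : Set.InjOn τ A) :
    Balance θ b (t + 1) τ A (paid + (payments Q).countP (fun w => θ ≤ w))
      ((ME b 2).afterDelivery t Q) := by
  obtain ⟨y, hty, hy⟩ := h
  -- in each step the offline schedule sends at most one packet
  have hone : (A.filter fun j => τ j = t).card ≤ 1 :=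
    Finset.card_le_one.mpr fun i hi j hj => by
      simp only [Finset.mem_filter] at hi hj
      exact hτ hi.1 hj.1 (hi.2.trans hj.2.symm)
  have hP : (A.filter fun j => t ≤ τ j).card ≤ (A.filter fun j => t + 1 ≤ τ j).card + 1 := by
    have : (A.filter fun j => t ≤ τ j) ⊆
        (A.filter fun j => t + 1 ≤ τ j) ∪ (A.filter fun j => τ j = t) := fun j hj => by
      simp only [Finset.mem_union, Finset.mem_filter] at hj ⊢
      rcases hj.2.lt_or_eq with h' | h'
      · exact Or.inl ⟨hj.1, h'⟩
      · exact Or.inr ⟨hj.1, h'.symm⟩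
    have := (Finset.card_le_card this).trans (Finset.card_union_le _ _)
    omega
  have hT : (A.filter fun j => t ≤ τ j ∧ τ j < y).card ≤
      (A.filter fun j => t + 1 ≤ τ j ∧ τ j < y).card + 1 := by
    have : (A.filter fun j => t ≤ τ j ∧ τ j < y) ⊆
        (A.filter fun j => t + 1 ≤ τ j ∧ τ j < y) ∪ (A.filter fun j => τ j = t) := fun j hj => by
      simp only [Finset.mem_union, Finset.mem_filter] at hj ⊢
      rcases hj.2.1.lt_or_eq with h' | h'
      · exact Or.inl ⟨hj.1, h', hj.2.2⟩
      · exact Or.inr ⟨hj.1, h'.symm⟩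
    have := (Finset.card_le_card this).trans (Finset.card_union_le _ _)
    omega
  have hTy : (A.filter fun j => t ≤ τ j ∧ τ j < y).card ≤ y - t := by
    rw [← Nat.card_Ico]
    refine Finset.card_le_card_of_injOn τ (fun j hj => ?_) (hτ.mono fun j hj => ?_)
    · simp only [Finset.coe_filter, Set.mem_ofPred_eq] at hj
      simpa using hj.2
    · simp only [Finset.coe_filter, Set.mem_ofPred_eq] at hj
      exact hj.1
  have hgt := hQ.heavyCount_le θ y
  by_cases hzero : heavyCount θ t (t + b) Q = 0
  · -- without heavy packets in the queue nothing is owed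
    have hgy : heavyCount θ t y Q = 0 := by
      refine Nat.le_zero.mp (hzero ▸ List.countP_mono_left fun q hq => ?_)
      simp only [decide_eq_true_eq]
      exact fun h' => ⟨h'.1, h'.2.1, hQ.vdl_lt q hq⟩
    exact ⟨t + 1, le_rfl, by omega⟩
  have hne : Q ≠ [] := by
    rintro rfl
    exact hzero rfl
  obtain ⟨e, m, h1, h2, he, hm, hmin, hmax⟩ := exists_argmin_argmax hne
  have hmθ : θ ≤ m.packet.value := by
    by_contra hlt
    refine hzero (List.countP_eq_zero.mpr fun q hq hqθ => hlt ?_)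
    simp only [decide_eq_true_eq] at hqθ
    exact hqθ.1.trans (hmax q hq)
  have hb1 := heavyCount_mono_right (θ := θ) (t := t) (show t + b ≤ t + 1 + b by omega) Q
  simp only [payments, MemorylessAlgorithm.afterDelivery, ME, meSelect, h1, h2]
  split_ifs with hlt
  · have hQ' := heavyCount_filter_of_first hQ he hmin θ
    have hQy := hQ' y
    have hQb := hQ' (t + 1 + b)
    simp only [List.countP_cons, List.countP_nil, decide_eq_true_eq, if_pos hmθ]
    rcases hty.lt_or_eq with hty | rfl
    · refine ⟨y, hty, ?_⟩
      split_ifs at hQy hQb ⊢ <;> omega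
    · refine ⟨t + 1, le_rfl, ?_⟩
      split_ifs at hQy hQb ⊢ <;> omega
  · have hQ' := heavyCount_filter_of_max hQ he hmin hm θ
    have hQy := hQ' y
    have hQb := hQ' (t + 1 + b)
    simp only [List.countP_cons, List.countP_nil, decide_eq_true_eq, if_pos hmθ] at hQy hQb ⊢
    rcases hty.lt_or_eq with hty | rfl
    · refine ⟨y, hty, ?_⟩
      split_ifs at hQy hQb ⊢ <;> omega
    · refine ⟨t + 1, le_rfl, ?_⟩
      split_ifs at hQy hQb ⊢ <;> omega

/-! ### Feasible schedules -/

section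
variable {n b : ℕ} {I : Fin n → Packet} {S : Schedule n}

theorem Schedule.Feasible.mem_buffer (hS : S.Feasible b I) {j : Fin n} {u : ℕ}
    (hj : j ∈ S.buffer u) :
    (I j).release ≤ u ∧ ∀ t, (I j).release ≤ t → t ≤ u → j ∈ S.buffer t := by
  induction u with
  | zero =>
    refine ⟨(hS.start j hj).le, fun t _ ht => ?_⟩
    rwa [Nat.le_zero.mp ht]
  | succ u ih =>
    rcases hS.next u j hj with h | ⟨h, -⟩
    · refine ⟨h.le, fun t h1 h2 => ?_⟩
      rwa [show t = u + 1 by omega]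
    · obtain ⟨h1, h2⟩ := ih h
      refine ⟨h1.trans (Nat.le_succ u), fun t ht htu => ?_⟩
      rcases htu.lt_or_eq with h' | rfl
      · exact h2 t ht (by omega)
      · exact hj

theorem Schedule.Feasible.sent_injective (hS : S.Feasible b I) {j : Fin n} {t u : ℕ}
    (ht : S.sent t = some j) (hu : S.sent u = some j) : t = u := by
  have key : ∀ {t u : ℕ}, S.sent t = some j → S.sent u = some j → ¬ t < u := by
    intro t u ht hu htu
    have h1 := (hS.mem_buffer (hS.sent_mem t j ht)).1
    have h2 := (hS.mem_buffer (hS.sent_mem u j hu)).2 (t + 1) (by omega) htu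
    rcases hS.next t j h2 with h | ⟨-, h⟩
    · omega
    · exact h ht
  have h1 := key ht hu
  have h2 := key hu ht
  omega

theorem Schedule.Feasible.sum_sent_le (hS : S.Feasible b I) (T : ℕ) :
    ∑ s ∈ Finset.range T, (S.sent s).elim 0 (fun j => (I j).value) ≤ S.throughput I := by
  classical
  have h1 : ∀ s, (S.sent s).elim 0 (fun j => (I j).value) =
      ∑ j : Fin n, if S.sent s = some j then (I j).value else 0 := fun s => by
    cases S.sent s with
    | none => simp
    | some i => simp
  simp only [h1]
  rw [Finset.sum_comm]
  unfold Schedule.throughput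
  refine Finset.sum_le_sum fun j _ => ?_
  split_ifs with hj
  · obtain ⟨u, hu⟩ := hj
    have : ∀ s, S.sent s = some j ↔ s = u :=
      fun s => ⟨fun hs => hS.sent_injective hs hu, fun hs => hs ▸ hu⟩
    simp only [this, Finset.sum_ite_eq']
    split_ifs <;> simp
  · push Not at hj
    simp [hj]

end

/-! ### The queue of ME -/

/-- Induction over the arrivals of a step. -/
theorem meAdmit_induction {b t : ℕ} (C : List (ι × Packet) → List (Pending ι) → Prop)
    {Q : List (Pending ι)} {new : List (ι × Packet)} (h0 : C [] Q)
    (hrec : C [] Q → C [] (recompute b t Q))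
    (hstep : ∀ l a r, new = l ++ a :: r → ∀ Q', C l Q' →
      C (l ++ [a]) (recompute b t (Q' ++ [⟨a.1, a.2, a.2.deadline⟩]))) :
    C new (meAdmit b t Q new) := by
  cases new with
  | nil => exact hrec h0
  | cons a as =>
    have key : ∀ r l Q', a :: as = l ++ r → C l Q' →
        C (a :: as) (r.foldl
          (fun Q' p => recompute b t (Q' ++ [⟨p.1, p.2, p.2.deadline⟩])) Q') := by
      intro r
      induction r with
      | nil =>
        intro l Q' hl hC
        rw [List.append_nil] at hl
        exact hl ▸ hC
      | cons c r ih =>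
        intro l Q' hl hC
        exact ih (l ++ [c]) _ (by simpa using hl) (hstep l c r hl Q' hC)
    exact key (a :: as) [] Q rfl h0

theorem exists_meAdmit_eq_recompute (b t : ℕ) (Q : List (Pending ι)) (new : List (ι × Packet)) :
    ∃ S, meAdmit b t Q new = recompute b t S := by
  cases new with
  | nil => exact ⟨Q, rfl⟩
  | cons a as =>
    have := meAdmit_induction (b := b) (t := t) (Q := Q) (new := a :: as)
      (fun l Q' => l = [] ∨ ∃ S, Q' = recompute b t S) (Or.inl rfl) (fun _ => Or.inl rfl)
      fun _ _ _ _ _ _ => Or.inr ⟨_, rfl⟩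
    simpa using this

section
variable {n : ℕ} (I : Fin n → Packet)

theorem mem_arrivals {t : ℕ} {a : Fin n × Packet} (ha : a ∈ arrivals I t) :
    a.2 = I a.1 ∧ (I a.1).release = t := by
  obtain ⟨j, hj, rfl⟩ := List.mem_map.mp ha
  exact ⟨rfl, by simpa using (List.mem_filter.mp hj).2⟩

theorem map_fst_arrivals (t : ℕ) :
    (arrivals I t).map Prod.fst = (List.finRange n).filter fun j => (I j).release = t := by
  simp [arrivals, Function.comp_def]

theorem nodup_arrivals (t : ℕ) : ((arrivals I t).map Prod.fst).Nodup := by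
  rw [map_fst_arrivals]
  exact (List.nodup_finRange n).filter _

/-- The entries of the queue belong to packets of the input that arrived before step `t` or are
listed in `l`, and virtual deadlines do not exceed deadlines. -/
structure IsQueueOf (b t : ℕ) (l : List (Fin n × Packet)) (Q : List (Pending (Fin n))) : Prop
    extends IsQueue b t Q where
  packet_eq : ∀ q ∈ Q, q.packet = I q.name
  vdl_le : ∀ q ∈ Q, q.vdl ≤ (I q.name).deadline
  arrived : ∀ q ∈ Q, (I q.name).release < t ∨ q.name ∈ l.map Prod.fst

variable {I}

theorem IsQueueOf.recompute {b t : ℕ} {l : List (Fin n × Packet)} {Q : List (Pending (Fin n))}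
    (h : IsQueueOf I b t l Q) : IsQueueOf I b t l (recompute b t Q) := by
  refine ⟨(isCompact_recompute b t h.nodup_name).toIsQueue, fun q hq => ?_, fun q hq => ?_,
    fun q hq => ?_⟩ <;> obtain ⟨-, q', hq', h1, h2, h3⟩ := mem_recompute hq
  · rw [← h1, ← h2]; exact h.packet_eq q' hq'
  · rw [← h1]; exact h3.trans (h.vdl_le q' hq')
  · rw [← h1]; exact h.arrived q' hq'

theorem notMem_of_arrivals_eq {t : ℕ} {l r : List (Fin n × Packet)} {a : Fin n × Packet}
    (h : arrivals I t = l ++ a :: r) : a.1 ∉ l.map Prod.fst := by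
  have hnd := nodup_arrivals I t
  rw [h, List.map_append, List.map_cons, List.nodup_append] at hnd
  exact fun hmem => hnd.2.2 _ hmem _ List.mem_cons_self rfl

theorem IsQueueOf.arrive {b t : ℕ} {l r : List (Fin n × Packet)} {a : Fin n × Packet}
    {Q : List (Pending (Fin n))} (h : IsQueueOf I b t l Q) (ha : arrivals I t = l ++ a :: r) :
    IsQueueOf I b t (l ++ [a])
      (BoundedQueue.recompute b t (Q ++ [⟨a.1, a.2, a.2.deadline⟩])) := by
  obtain ⟨ha2, har⟩ := mem_arrivals I (t := t) (a := a) (by rw [ha]; simp)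
  have hname : ((Q ++ [(⟨a.1, a.2, a.2.deadline⟩ : Pending (Fin n))]).map Pending.name).Nodup := by
    rw [List.map_append, List.nodup_append]
    refine ⟨h.nodup_name, by simp, ?_⟩
    intro x hx y hy hxy
    obtain ⟨q, hq, rfl⟩ := List.mem_map.mp hx
    simp only [List.map_cons, List.map_nil, List.mem_singleton] at hy
    rcases h.arrived q hq with h' | h' <;> rw [hxy, hy] at h'
    · omega
    · exact notMem_of_arrivals_eq ha h'
  refine ⟨(isCompact_recompute b t hname).toIsQueue, fun q hq => ?_, fun q hq => ?_,
    fun q hq => ?_⟩ <;> obtain ⟨-, q', hq', h1, h2, h3⟩ := mem_recompute hq <;>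
    rw [List.mem_append, List.mem_singleton] at hq'
  · rw [← h1, ← h2]
    rcases hq' with hq' | rfl
    · exact h.packet_eq q' hq'
    · exact ha2
  · rw [← h1]
    rcases hq' with hq' | rfl
    · exact h3.trans (h.vdl_le q' hq')
    · rwa [← ha2]
  · rw [← h1]
    rcases hq' with hq' | rfl
    · exact (h.arrived q' hq').imp_right fun h' => by
        rw [List.map_append]; exact List.mem_append_left _ h'
    · exact Or.inr (by simp)

variable (I)

/-- The queue of an algorithm before the arrivals of step `t`. -/
def MemorylessAlgorithm.queueBefore (A : MemorylessAlgorithm (Fin n)) :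
    ℕ → List (Pending (Fin n))
  | 0 => []
  | t + 1 => A.afterDelivery t (A.queue I t)

theorem queue_ME (b : ℕ) (α : ℝ≥0) (t : ℕ) :
    (ME b α).queue I t = meAdmit b t ((ME b α).queueBefore I t) (arrivals I t) := by
  cases t <;> rfl

theorem afterDelivery_sublist {A : MemorylessAlgorithm (Fin n)} (t : ℕ)
    (Q : List (Pending (Fin n))) : (A.afterDelivery t Q).Sublist Q := by
  unfold MemorylessAlgorithm.afterDelivery
  split
  · exact List.Sublist.refl _
  · exact List.filter_sublist

theorem isQueueOf_queue_of_before {b t : ℕ} {α : ℝ≥0}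
    (h : IsQueueOf I b t [] ((ME b α).queueBefore I t)) :
    IsQueueOf I b t (arrivals I t) ((ME b α).queue I t) := by
  rw [queue_ME]
  exact meAdmit_induction (fun l Q => IsQueueOf I b t l Q) h (fun h => h.recompute)
    fun l a r ha Q' hQ' => hQ'.arrive ha

theorem isQueueOf_queueBefore (b t : ℕ) (α : ℝ≥0) :
    IsQueueOf I b t [] ((ME b α).queueBefore I t) := by
  induction t with
  | zero =>
    refine ⟨⟨?_, ?_, ?_⟩, ?_, ?_, ?_⟩ <;> simp [MemorylessAlgorithm.queueBefore]
  | succ t ih =>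
    have h := isQueueOf_queue_of_before I ih
    have hs : ((ME b α).queueBefore I (t + 1)).Sublist ((ME b α).queue I t) :=
      afterDelivery_sublist t _
    refine ⟨⟨h.nodup_name.sublist (hs.map _), h.nodup_vdl.sublist (hs.map _), fun q hq => ?_⟩,
      fun q hq => h.packet_eq q (hs.subset hq), fun q hq => h.vdl_le q (hs.subset hq),
      fun q hq => Or.inl ?_⟩
    · have := h.vdl_lt q (hs.subset hq)
      omega
    · rcases h.arrived q (hs.subset hq) with h' | h'
      · omega
      · obtain ⟨a, ha, haq⟩ := List.mem_map.mp h'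
        have := (mem_arrivals I ha).2
        rw [haq] at this
        omega

theorem isQueueOf_queue (b t : ℕ) (α : ℝ≥0) :
    IsQueueOf I b t (arrivals I t) ((ME b α).queue I t) :=
  isQueueOf_queue_of_before I (isQueueOf_queueBefore I b t α)

theorem isCompact_queue (b t : ℕ) (α : ℝ≥0) : IsCompact b t ((ME b α).queue I t) := by
  refine ⟨(isQueueOf_queue I b t α).toIsQueue, ?_⟩
  rw [queue_ME]
  obtain ⟨S, hS⟩ := exists_meAdmit_eq_recompute b t ((ME b α).queueBefore I t) (arrivals I t)
  exact ⟨_, hS ▸ map_vdl_recompute b t S⟩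

theorem mem_queue (b t : ℕ) (α : ℝ≥0) {q : Pending (Fin n)} (hq : q ∈ (ME b α).queue I t) :
    (I q.name).release = t ∨ q.name ∈ ((ME b α).queueBefore I t).map Pending.name := by
  have key : ∀ q ∈ (ME b α).queue I t, q.name ∈ (arrivals I t).map Prod.fst ∨
      q.name ∈ ((ME b α).queueBefore I t).map Pending.name := by
    rw [queue_ME]
    refine meAdmit_induction (fun l Q => ∀ q ∈ Q, q.name ∈ l.map Prod.fst ∨
      q.name ∈ ((ME b α).queueBefore I t).map Pending.name)
      (fun q hq => Or.inr (List.mem_map_of_mem hq)) (fun h q hq => ?_)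
      (fun l a r _ Q' hQ' q hq => ?_) <;> obtain ⟨-, q', hq', h1, -⟩ := mem_recompute hq <;>
      rw [← h1]
    · exact h q' hq'
    · rw [List.mem_append, List.mem_singleton] at hq'
      rcases hq' with hq' | rfl
      · exact (hQ' q' hq').imp_left fun h' => by
          rw [List.map_append]; exact List.mem_append_left _ h'
      · exact Or.inl (by simp)
  refine (key q hq).imp_left fun h => ?_
  obtain ⟨a, ha, haq⟩ := List.mem_map.mp h
  exact haq ▸ (mem_arrivals I ha).2

theorem feasible_run_ME (b : ℕ) (α : ℝ≥0) : ((ME b α).run I).Feasible b I where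
  capacity t := by
    refine (List.toFinset_card_le _).trans ?_
    rw [List.length_map, queue_ME]
    obtain ⟨S, hS⟩ := exists_meAdmit_eq_recompute b t ((ME b α).queueBefore I t) (arrivals I t)
    exact hS ▸ length_recompute_le b t S
  not_expired t j hj := by
    obtain ⟨q, hq, rfl⟩ := List.mem_map.mp (List.mem_toFinset.mp hj)
    refine le_trans ?_ ((isQueueOf_queue I b t α).vdl_le q hq)
    obtain ⟨S, hS⟩ := exists_meAdmit_eq_recompute b t ((ME b α).queueBefore I t) (arrivals I t)
    rw [queue_ME, hS] at hq
    exact (mem_recompute hq).1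
  start j hj := by
    obtain ⟨q, hq, rfl⟩ := List.mem_map.mp (List.mem_toFinset.mp hj)
    rcases mem_queue I b 0 α hq with h | h
    · exact h
    · simp [MemorylessAlgorithm.queueBefore] at h
  next t j hj := by
    obtain ⟨q, hq, rfl⟩ := List.mem_map.mp (List.mem_toFinset.mp hj)
    refine (mem_queue I b (t + 1) α hq).imp_right fun h => ?_
    obtain ⟨q', hq', hqq⟩ := List.mem_map.mp h
    rw [← hqq]
    refine ⟨List.mem_toFinset.mpr (List.mem_map_of_mem ((afterDelivery_sublist t _).subset hq')),
      fun hs => ?_⟩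
    obtain ⟨s, hs1, hs2⟩ := Option.map_eq_some_iff.mp hs
    simp only [MemorylessAlgorithm.queueBefore, MemorylessAlgorithm.afterDelivery, hs1] at hq'
    have := (List.mem_filter.mp hq').2
    simp [hs2] at this
  sent_mem t j hj := by
    obtain ⟨s, hs1, hs2⟩ := Option.map_eq_some_iff.mp hj
    exact List.mem_toFinset.mpr (hs2 ▸ List.mem_map_of_mem (meSelect_mem hs1))

end

/-! ### Competitiveness -/

section
variable {n b : ℕ} {I : Fin n → Packet} {S : Schedule n}

/-- The number of payments of value at least `θ` before step `t`. -/
def paidCount (I : Fin n → Packet) (b : ℕ) (θ : ℝ≥0) (t : ℕ) : ℕ :=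
  ∑ s ∈ Finset.range t, (payments ((ME b 2).queue I s)).countP fun w => θ ≤ w

theorem balance_queueBefore (hS : S.Feasible b I) {θ : ℝ≥0} {O : Finset (Fin n)} {τ : Fin n → ℕ}
    (hO : ∀ j ∈ O, θ ≤ (I j).value) (hτ : ∀ j ∈ O, S.sent (τ j) = some j) (t : ℕ) :
    Balance θ b t τ (O.filter fun j => (I j).release < t) (paidCount I b θ t)
      ((ME b 2).queueBefore I t) := by
  have hinj : Set.InjOn τ O := fun i hi j hj hij =>
    Option.some_injective _ ((hτ i hi).symm.trans (hij ▸ hτ j hj))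
  induction t with
  | zero => exact ⟨0, le_rfl, by simp⟩
  | succ t ih =>
    have harr : Balance θ b t τ
        (O.filter fun j => (I j).release < t ∨ j ∈ (arrivals I t).map Prod.fst)
        (paidCount I b θ t) ((ME b 2).queue I t) := by
      rw [queue_ME]
      refine (meAdmit_induction (fun l Q => IsQueueOf I b t l Q ∧ Balance θ b t τ
        (O.filter fun j => (I j).release < t ∨ j ∈ l.map Prod.fst) (paidCount I b θ t) Q)
        ⟨isQueueOf_queueBefore I b t 2, by simpa using ih⟩
        (fun ⟨h1, h2⟩ => ⟨h1.recompute, h2.recompute h1.toIsQueue (List.Sublist.refl _)⟩)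
        fun l a r ha Q' ⟨h1, h2⟩ => ⟨h1.arrive ha, ?_⟩).2
      obtain ⟨ha2, har⟩ := mem_arrivals I (t := t) (a := a) (by rw [ha]; simp)
      by_cases haO : a.1 ∈ O
      · have hset : (O.filter fun j => (I j).release < t ∨ j ∈ (l ++ [a]).map Prod.fst) =
            insert a.1 (O.filter fun j => (I j).release < t ∨ j ∈ l.map Prod.fst) := by
          ext j
          simp only [Finset.mem_filter, Finset.mem_insert, List.map_append, List.mem_append,
            List.map_cons, List.map_nil, List.mem_singleton]
          constructor
          · rintro ⟨h1, h2 | h2 | h2⟩ <;> tauto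
          · rintro (rfl | h) <;> tauto
        have hsent := hS.sent_mem _ _ (hτ a.1 haO)
        have hrel := (hS.mem_buffer hsent).1
        rw [hset]
        refine h2.arrive h1.toIsQueue (p := ⟨a.1, a.2, a.2.deadline⟩) ?_ ?_ ?_ ?_ ?_
        · simp only [Finset.mem_filter, not_and, not_or]
          exact fun _ => ⟨by omega, notMem_of_arrivals_eq ha⟩
        · simpa only [ha2] using hO a.1 haO
        · exact har ▸ hrel
        · simpa only [ha2] using hS.not_expired _ _ hsent
        · -- what the offline schedule still has to send is in its buffer
          refine (Finset.card_le_card fun j hj => ?_).trans (hS.capacity t)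
          rw [← hset] at hj
          simp only [Finset.mem_filter] at hj
          obtain ⟨⟨hjO, hjr⟩, hjt⟩ := hj
          refine (hS.mem_buffer (hS.sent_mem _ _ (hτ j hjO))).2 t ?_ hjt
          rcases hjr with hjr | hjr
          · exact hjr.le
          · obtain ⟨c, hc, rfl⟩ := List.mem_map.mp hjr
            refine (mem_arrivals I (t := t) ?_).2.le
            rw [ha]
            simp only [List.mem_append, List.mem_cons, List.not_mem_nil, or_false] at hc ⊢
            tauto
      · have hset : (O.filter fun j => (I j).release < t ∨ j ∈ (l ++ [a]).map Prod.fst) =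
            O.filter fun j => (I j).release < t ∨ j ∈ l.map Prod.fst := by
          refine Finset.filter_congr fun j hj => ?_
          have : j ≠ a.1 := fun h => haO (h ▸ hj)
          simp [this]
        rw [hset]
        exact h2.recompute h1.toIsQueue (List.sublist_append_left _ _)
    have hset : (O.filter fun j => (I j).release < t ∨ j ∈ (arrivals I t).map Prod.fst) =
        O.filter fun j => (I j).release < t + 1 := by
      refine Finset.filter_congr fun j _ => ?_
      rw [map_fst_arrivals]
      simp only [List.mem_filter, List.mem_finRange, true_and, decide_eq_true_eq]
      omega
    rw [hset] at harr
    have hdel := harr.deliver (isCompact_queue I b t 2)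
      (hinj.mono fun j hj => (Finset.mem_filter.mp (Finset.mem_coe.mp hj)).1)
    rwa [show paidCount I b θ (t + 1) = _ from Finset.sum_range_succ _ _]

/-- At every value threshold the payments outnumber the packets sent by the offline schedule. -/
theorem card_le_paidCount (hS : S.Feasible b I) {θ : ℝ≥0} {O : Finset (Fin n)}
    (hO : ∀ j ∈ O, θ ≤ (I j).value) (hsent : ∀ j ∈ O, ∃ t, S.sent t = some j) {T : ℕ}
    (hT : ∀ j, (I j).deadline < T) : O.card ≤ paidCount I b θ T := by
  choose! τ hτ using hsent
  obtain ⟨y, hy, h⟩ := balance_queueBefore hS hO hτ T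
  have hlt : ∀ j ∈ O, τ j < T := fun j hj =>
    (hS.not_expired _ _ (hS.sent_mem _ _ (hτ j hj))).trans_lt (hT j)
  have h1 : O.filter (fun j => (I j).release < T) = O := Finset.filter_true_of_mem fun j hj =>
    (hS.mem_buffer (hS.sent_mem _ _ (hτ j hj))).1.trans_lt (hlt j hj)
  have h2 : O.filter (fun j => T ≤ τ j) = ∅ :=
    Finset.filter_false_of_mem fun j hj => not_le.mpr (hlt j hj)
  have h3 : O.filter (fun j => T ≤ τ j ∧ τ j < y) = ∅ :=
    Finset.filter_false_of_mem fun j hj hj' => not_le.mpr (hlt j hj) hj'.1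
  rw [h1, h2, h3, Finset.card_empty] at h
  have h4 := (isQueueOf_queueBefore I b T 2).heavyCount_le θ y
  omega

end

/-- If at every threshold `θ` the multiset `B` has at least as many elements `≥ θ` as `A`, then
its sum is at least that of `A`. -/
theorem sum_le_sum_of_countP_le (A B : Multiset ℝ≥0)
    (h : ∀ θ, A.countP (fun w => θ ≤ w) ≤ B.countP (fun w => θ ≤ w)) : A.sum ≤ B.sum := by
  classical
  induction hn : A.card generalizing A B with
  | zero => rw [Multiset.card_eq_zero.mp hn]; simp
  | succ k ih =>
    have hne : A.toFinset.Nonempty := by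
      rw [Multiset.toFinset_nonempty]
      rintro rfl
      simp at hn
    obtain ⟨a, ha, hmax⟩ := A.toFinset.exists_max_image id hne
    rw [Multiset.mem_toFinset] at ha
    obtain ⟨c, hc, hac⟩ := Multiset.countP_pos.mp
      ((Multiset.countP_pos.mpr ⟨a, ha, le_rfl⟩).trans_le (h a))
    obtain ⟨A', rfl⟩ := Multiset.exists_cons_of_mem ha
    obtain ⟨B', rfl⟩ := Multiset.exists_cons_of_mem hc
    rw [Multiset.sum_cons, Multiset.sum_cons]
    refine add_le_add hac (ih A' B' (fun θ => ?_) (by simpa using hn))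
    by_cases hθ : θ ≤ a
    · have := h θ
      rw [Multiset.countP_cons, Multiset.countP_cons, if_pos hθ, if_pos (hθ.trans hac)] at this
      omega
    · rw [Multiset.countP_eq_zero.mpr fun w hw hθw => hθ (hθw.trans
        (hmax w (Multiset.mem_toFinset.mpr (Multiset.mem_cons_of_mem hw))))]
      exact Nat.zero_le _

theorem throughput_le {n b : ℕ} {I : Fin n → Packet} {S : Schedule n} (hS : S.Feasible b I) :
    S.throughput I ≤ 3 * ((ME b 2).run I).throughput I := by
  classical
  obtain ⟨T, hT⟩ : ∃ T, ∀ j, (I j).deadline < T :=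
    ⟨(Finset.univ.sup fun j => (I j).deadline) + 1, fun j => Nat.lt_succ_of_le
      (Finset.le_sup (f := fun j => (I j).deadline) (Finset.mem_univ j))⟩
  set O : Finset (Fin n) := Finset.univ.filter fun j => ∃ t, S.sent t = some j with hOdef
  set B : Multiset ℝ≥0 :=
    ∑ s ∈ Finset.range T, (payments ((ME b 2).queue I s) : Multiset ℝ≥0) with hB
  have hdom : (O.val.map fun j => (I j).value).sum ≤ B.sum := by
    refine sum_le_sum_of_countP_le _ _ fun θ => ?_
    have h1 := card_le_paidCount (θ := θ) (O := O.filter fun j => θ ≤ (I j).value) hS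
      (fun j hj => (Finset.mem_filter.mp hj).2)
      (fun j hj => (Finset.mem_filter.mp (Finset.mem_filter.mp hj).1).2) hT
    rw [Multiset.countP_map]
    refine h1.trans (le_of_eq ?_)
    rw [hB, paidCount, ← Multiset.coe_countPAddMonoidHom, map_sum]
    simp
  calc S.throughput I = ∑ j ∈ O, (I j).value := by
        rw [hOdef, Finset.sum_filter]; rfl
    _ ≤ B.sum := hdom
    _ = ∑ s ∈ Finset.range T, (payments ((ME b 2).queue I s)).sum := by
        rw [hB, Multiset.sum_sum]; simp
    _ ≤ ∑ s ∈ Finset.range T,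
          3 * (((ME b 2).run I).sent s).elim 0 (fun j => (I j).value) := by
        refine Finset.sum_le_sum fun s _ => (sum_payments_le _).trans (le_of_eq ?_)
        change _ = 3 * ((meSelect 2 ((ME b 2).queue I s)).map Pending.name).elim 0 _
        cases hs : meSelect 2 ((ME b 2).queue I s) with
        | none => simp
        | some q => simp [(isQueueOf_queue I b s 2).packet_eq q (meSelect_mem hs)]
    _ ≤ 3 * ((ME b 2).run I).throughput I := by
        rw [← Finset.mul_sum]
        exact mul_le_mul_right ((feasible_run_ME I b 2).sum_sent_le T) 3

end BoundedQueue

end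

theorem theorem1 (b : ℕ) (hb : 0 < b) :
    BoundedQueue.StrictlyCompetitive 3 b (fun n => BoundedQueue.ME (ι := Fin n) b 2) :=
  fun _ I => ⟨BoundedQueue.feasible_run_ME I b 2, fun _ hS => BoundedQueue.throughput_le hS⟩
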